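/- Let $n\ge 2$, and let $\mathcal I$ denote the identity superoperator (linear map) on $\mathbb C^{n\times n}$. Let $\gamma>0$, $p\in[-\frac1{n^2-1},1]$, let $\Lambda_p X = pX+(1-p)\frac{I}{n}\operatorname{Tr}X$ and $\mathcal L_0=\gamma(\Lambda_p-\mathcal I)$. Let $H=H^\dagger$ and $L_j$ ($j$ in a finite index set) be $n\times n$ complex matrices with $\operatorname{Tr}L_j=0$ for all $j$, and let $$\mathcal L_I=-i[H,\,\cdot\,]+\sum_j\Bigl(L_j\,\cdot\,L_j^\dagger-\tfrac12\{L_j^\dagger L_j,\,\cdot\,\}\Bigr).$$ Fix real $t_0,t$. For real $\lambda$ let $\Phi_\lambda(s)$ be the solution of $\frac{d}{ds}\Phi_\lambda(s)=(\mathcal L_0+\lambda\mathcal L_I)\Phi_\lambda(s)$, $\Phi_\lambda(t_0)=\mathcal I$, and let $$\mathfrak P(\Phi)=\int_{U(n)}U^\dagger\,\Phi(U\,\cdot\,U^\dagger)\,U\,dU$$ with the normalized Haar measure $dU$. Then: (1) For all sufficiently small $\lambda$ and every $s$ between $t_0$ and $t$ there is exactly one superoperator $\mathfrak K_\lambda(s)$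 with $\frac{d}{ds}\mathfrak P(\Phi_\lambda(s))=\mathfrak K_\lambda(s)\,\mathfrak P(\Phi_\lambda(s))$. (2) As $\lambda\to0$, with $t$ and $t_0$ fixed, $$\mathfrak K_\lambda(t)=-\tilde\gamma_\lambda(t)\Bigl(\mathcal I-\frac In\operatorname{Tr}(\,\cdot\,)\Bigr)+O(\lambda^3).$$ (3) For every real $\lambda$, the second-order generator is exactly $$\mathcal L_0+\lambda\mathfrak P(\mathcal L_I)+\lambda^2(t-t_0)\bigl(\mathfrak P(\mathcal L_I^2)-\mathfrak P(\mathcal L_I)^2\bigr)=-\tilde\gamma_\lambda(t)\Bigl(\mathcal I-\frac In\operatorname{Tr}(\,\cdot\,)\Bigr).$$ Here, with $\langle A\rangle=n^{-1}\operatorname{Tr}A$ and $G=\sum_jL_j^\dagger L_j$, $$\tilde\gamma_\lambda(t)=\gamma(1-p)+\lambda\frac{n^2}{n^2-1}\langle G\rangle+\lambda^2(t-t_0)\Bigl[\frac{n^2}{n^2-1}\Bigl(2(\langle H^2\rangle-\langle H\rangle^2)-\sum_{j,k}|\langle L_jL_k\rangle|^2-\tfrac12\langle G^2\rangle-\tfrac12\langle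 G\rangle^2\Bigr)+\frac{n^4}{(n^2-1)^2}\langle G\rangle^2\Bigr].$$ -/

import Mathlib

open scoped Matrix Matrix.Norms.L2Operator Topology

/-- Complex `n × n` matrices (with the operator norm). -/
abbrev Mat (n : ℕ) : Type := Matrix (Fin n) (Fin n) ℂ

/-- Superoperators: linear maps on `n × n` matrices (all of them are continuous), with the
operator norm; the product is composition and `1` is the identity superoperator. -/
abbrev SuperOp (n : ℕ) : Type := Mat n →L[ℂ] Mat n

noncomputable instance superOp_normedRing (n : ℕ) : NormedRing (SuperOp n) :=
  ContinuousLinearMap.toNormedRing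

noncomputable instance superOp_normedAlgebra (n : ℕ) : NormedAlgebra ℂ (SuperOp n) :=
  ContinuousLinearMap.toNormedAlgebra

noncomputable instance superOp_normedSpaceReal (n : ℕ) : NormedSpace ℝ (SuperOp n) :=
  NormedSpace.complexToReal

noncomputable instance superOp_moduleReal (n : ℕ) : Module ℝ (SuperOp n) :=
  (superOp_normedSpaceReal n).toModule

/-- The superoperator `X ↦ A X B`. -/
noncomputable def sandwich {n : ℕ} (A B : Mat n) : SuperOp n :=
  LinearMap.toContinuousLinearMap (LinearMap.mulLeft ℂ A ∘ₗ LinearMap.mulRight ℂ B)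

theorem sandwich_apply {n : ℕ} (A B X : Mat n) : sandwich A B X = A * X * B := by
  simp [sandwich, Matrix.mul_assoc]

/-- The completely depolarizing superoperator `X ↦ (Tr X) I / n`. -/
noncomputable def fullDepol (n : ℕ) : SuperOp n :=
  LinearMap.toContinuousLinearMap
    ((Matrix.traceLinearMap (Fin n) ℂ ℂ).smulRight ((n : ℂ)⁻¹ • (1 : Mat n)))

theorem fullDepol_apply {n : ℕ} (X : Mat n) :
    fullDepol n X = X.trace • ((n : ℂ)⁻¹ • (1 : Mat n)) := by
  simp [fullDepol]

/-- `Λ_p X = p X + (1 - p) (Tr X) I / n`. -/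
noncomputable def depolarizing (n : ℕ) (p : ℝ) : SuperOp n :=
  (p : ℂ) • (1 : SuperOp n) + (1 - (p : ℂ)) • fullDepol n

/-- The free generator `γ (Λ_p - 𝓘)`. -/
noncomputable def freeGenerator (n : ℕ) (γ p : ℝ) : SuperOp n :=
  (γ : ℂ) • (depolarizing n p - 1)

/-- The GKSL generator
`X ↦ -i [H, X] + ∑ j, (L j X (L j)† - 1/2 {(L j)† L j, X})`. -/
noncomputable def gksl {n : ℕ} {J : Type*} [Fintype J] (H : Mat n) (L : J → Mat n) : SuperOp n :=
  (-Complex.I) • (sandwich H 1 - sandwich 1 H)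
    + ∑ j, (sandwich (L j) (L j)ᴴ
        - (1 / 2 : ℂ) • (sandwich ((L j)ᴴ * L j) 1 + sandwich 1 ((L j)ᴴ * L j)))

/-- The unitary group `U(n)` is compact. -/
instance unitaryGroup_compactSpace (n : ℕ) : CompactSpace (Matrix.unitaryGroup (Fin n) ℂ) := by
  have hc : IsClosed ((Matrix.unitaryGroup (Fin n) ℂ : Submonoid (Mat n)) : Set (Mat n)) :=
    isClosed_unitary
  have hK : IsCompact (Set.pi Set.univ fun _ : Fin n =>
      Set.pi Set.univ fun _ : Fin n => Metric.closedBall (0 : ℂ) 1) :=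
    isCompact_univ_pi fun _ => isCompact_univ_pi fun _ => isCompact_closedBall 0 1
  refine isCompact_iff_compactSpace.mp (IsCompact.of_isClosed_subset hK hc ?_)
  intro U hU i _ j _
  simpa using entry_norm_bound_of_unitary hU i j

/-- The Borel σ-algebra of the unitary group `U(n)`. -/
noncomputable instance unitaryGroup_measurableSpace (n : ℕ) :
    MeasurableSpace (Matrix.unitaryGroup (Fin n) ℂ) :=
  borel _

instance unitaryGroup_borelSpace (n : ℕ) : BorelSpace (Matrix.unitaryGroup (Fin n) ℂ) :=
  ⟨rfl⟩

instance unitaryGroup_isTopologicalGroup (n : ℕ) :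
    IsTopologicalGroup (Matrix.unitaryGroup (Fin n) ℂ) :=
  inferInstanceAs (IsTopologicalGroup (unitary (Mat n)))

/-- The Haar measure of `U(n)`, normalized to total mass `1`. -/
noncomputable def unitaryHaar (n : ℕ) :
    MeasureTheory.Measure (Matrix.unitaryGroup (Fin n) ℂ) :=
  MeasureTheory.Measure.haarMeasure ⊤

/-- The twirling hyperprojector `Φ ↦ ∫ U† Φ(U · U†) U dU` over the whole unitary group. -/
noncomputable def twirl {n : ℕ} (Φ : SuperOp n) : SuperOp n :=
  ∫ U : Matrix.unitaryGroup (Fin n) ℂ,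
    sandwich (U : Mat n)ᴴ (U : Mat n) * Φ * sandwich (U : Mat n) (U : Mat n)ᴴ ∂(unitaryHaar n)

/-- `Φ` solves the Cauchy problem `d/dt Φ(t) = 𝓛 Φ(t)`, `Φ(t₀) = 𝓘`. -/
def IsPropagator {n : ℕ} (𝓛 : SuperOp n) (t₀ : ℝ) (Φ : ℝ → SuperOp n) : Prop :=
  Φ t₀ = 1 ∧ ∀ t, HasDerivAt Φ (𝓛 * Φ t) t

/-- `K` is a generator at time `t` of the projected dynamics: at the time `t`,
`d/dt 𝔓(Φ(t)) = K 𝔓(Φ(t))`. -/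
def IsProjectedGenerator {n : ℕ} (Φ : ℝ → SuperOp n) (t : ℝ) (K : SuperOp n) : Prop :=
  HasDerivAt (fun s => twirl (Φ s)) (K * twirl (Φ t)) t

/-- The average `⟨A⟩ = Tr A / n` in the chaotic state. -/
noncomputable def avg {n : ℕ} (A : Mat n) : ℂ := (n : ℂ)⁻¹ * A.trace

/-- `G = ∑ j, (L j)† L j`. -/
noncomputable def jumpSum {n : ℕ} {J : Type*} [Fintype J] (L : J → Mat n) : Mat n := ∑ j, (L j)ᴴ * L j

/-- The depolarization rate up to the second order in `lam`. -/
noncomputable def depolRate {n : ℕ} {J : Type*} [Fintype J] (γ p : ℝ) (H : Mat n) (L : J → Mat n)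
    (t₀ t lam : ℝ) : ℂ :=
  γ * (1 - p) + lam * ((n : ℂ) ^ 2 / ((n : ℂ) ^ 2 - 1) * avg (jumpSum L))
    + (lam : ℂ) ^ 2 * (t - t₀) *
      ((n : ℂ) ^ 2 / ((n : ℂ) ^ 2 - 1) *
          (2 * (avg (H ^ 2) - avg H ^ 2) - ∑ j, ∑ k, ((‖avg (L j * L k)‖ : ℂ)) ^ 2
            - 1 / 2 * avg (jumpSum L ^ 2) - 1 / 2 * avg (jumpSum L) ^ 2)
        + (n : ℂ) ^ 4 / ((n : ℂ) ^ 2 - 1) ^ 2 * avg (jumpSum L) ^ 2)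

/-! Write `D` for `fullDepol n`, `Q = 1 - D`, `M = gksl H L`, `c = γ(1-p)`. Right invariance of Haar
measure makes every twirl commute with unitary conjugations, and the commutant of these is spanned
by `1` and `D` (`exists_eq_smul_add_smul_fullDepol_of_comm`). Two functionals unchanged by the
twirl, the superoperator trace and `Φ ↦ Tr Φ(I)/n`, fix the two coefficients, which gives the closed
form `twirl_eq`.

The free generator is `-cQ`. Since `M` annihilates the trace, `D M = 0`, so `Q` acts as the identity
on the range of `exp(xM) Q` and the two parts of the dynamics decouple there: `Φ(s) Q = e^{-c(s-t₀)}
exp((s-t₀)λM) Q`. The coefficient of `Q` in a twirl ignores anything factoring through `D` on the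
right, so the projected dynamics is `e^{-c(s-t₀)} f((s-t₀)λ) Q + D` with `f(x) = twirlCoeff n
(exp(xM))`. This is invertible wherever `f ≠ 0`, hence its generator is uniquely `(-c + λ f'/f) Q`
(`IsPropagator.isProjectedGenerator_iff`).

Expanding `f'/f` to first order at `0` (`flowCoeff_logDeriv_isBigO`) gives the rate up to `O(λ³)`;
the traces of `M` and `M²` turn it into the stated formula (`depolRate_eq`). -/

theorem superOp_mul_apply {n : ℕ} (S T : SuperOp n) (X : Mat n) : (S * T) X = S (T X) := rfl

/-- Conjugation `X ↦ U X U†` as a superoperator. -/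
noncomputable def conjOp {n : ℕ} (U : Mat n) : SuperOp n := sandwich U Uᴴ

theorem conjOp_apply {n : ℕ} (U X : Mat n) : conjOp U X = U * X * Uᴴ := sandwich_apply _ _ _

theorem sandwich_mul_sandwich {n : ℕ} (A B C D : Mat n) :
    sandwich A B * sandwich C D = sandwich (A * C) (D * B) := by
  ext1 X
  simp [sandwich_apply, Matrix.mul_assoc]

theorem sandwich_one_one {n : ℕ} : sandwich (1 : Mat n) 1 = 1 := by
  ext1 X
  simp [sandwich_apply]

theorem conjTranspose_mul_self_of_unitary {n : ℕ} (U : Matrix.unitaryGroup (Fin n) ℂ) :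
    (U : Mat n)ᴴ * (U : Mat n) = 1 := Matrix.UnitaryGroup.star_mul_self U

theorem mul_conjTranspose_self_of_unitary {n : ℕ} (U : Matrix.unitaryGroup (Fin n) ℂ) :
    (U : Mat n) * (U : Mat n)ᴴ = 1 := (Matrix.mem_unitaryGroup_iff).1 U.2

/-! ### Haar averaging and invariance of the twirl -/

theorem continuous_sandwich {n : ℕ} :
    Continuous fun q : Mat n × Mat n => sandwich q.1 q.2 := by
  have h : Continuous fun q : Mat n × Mat n =>
      (ContinuousLinearMap.mul ℂ (Mat n) q.1) * ((ContinuousLinearMap.mul ℂ (Mat n)).flip q.2) := by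
    fun_prop
  convert h using 2 with q
  ext1 X
  simp [sandwich_apply, Matrix.mul_assoc]

theorem continuous_twirlIntegrand {n : ℕ} (Φ : SuperOp n) :
    Continuous fun U : Matrix.unitaryGroup (Fin n) ℂ =>
      sandwich (U : Mat n)ᴴ (U : Mat n) * Φ * sandwich (U : Mat n) (U : Mat n)ᴴ := by
  have h1 : Continuous fun U : Matrix.unitaryGroup (Fin n) ℂ => (U : Mat n) :=
    continuous_subtype_val
  have h2 : Continuous fun U : Matrix.unitaryGroup (Fin n) ℂ => (U : Mat n)ᴴ :=
    h1.star
  exact ((continuous_sandwich.comp (h2.prodMk h1)).mul continuous_const).mul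
    (continuous_sandwich.comp (h1.prodMk h2))

instance isProbabilityMeasure_unitaryHaar (n : ℕ) :
    MeasureTheory.IsProbabilityMeasure (unitaryHaar n) :=
  ⟨MeasureTheory.Measure.haarMeasure_self⟩

instance isHaarMeasure_unitaryHaar (n : ℕ) : (unitaryHaar n).IsHaarMeasure := by
  unfold unitaryHaar; infer_instance

theorem integrable_twirlIntegrand {n : ℕ} (Φ : SuperOp n) :
    MeasureTheory.Integrable (fun U : Matrix.unitaryGroup (Fin n) ℂ =>
      sandwich (U : Mat n)ᴴ (U : Mat n) * Φ * sandwich (U : Mat n) (U : Mat n)ᴴ)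
      (unitaryHaar n) :=
  (continuous_twirlIntegrand Φ).integrable_of_hasCompactSupport
    (HasCompactSupport.of_compactSpace _)

/-- A right translate of the measure is again a Haar probability measure, and such a measure is
unique. -/
instance isMulRightInvariant_unitaryHaar (n : ℕ) : (unitaryHaar n).IsMulRightInvariant := by
  refine ⟨fun V => ?_⟩
  have : MeasureTheory.IsProbabilityMeasure ((unitaryHaar n).map (· * V)) :=
    MeasureTheory.Measure.isProbabilityMeasure_map (by fun_prop)
  exact MeasureTheory.Measure.isHaarMeasure_eq_of_isProbabilityMeasure _ _

/-- A linear functional invariant under unitary conjugation does not see the twirl. -/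
theorem map_twirl {n : ℕ} (φ : SuperOp n →L[ℂ] ℂ)
    (hφ : ∀ (U : Matrix.unitaryGroup (Fin n) ℂ) (Φ : SuperOp n),
      φ (sandwich (U : Mat n)ᴴ (U : Mat n) * Φ * sandwich (U : Mat n) (U : Mat n)ᴴ) = φ Φ)
    (Φ : SuperOp n) : φ (twirl Φ) = φ Φ := by
  rw [twirl, ← φ.integral_comp_comm (integrable_twirlIntegrand Φ)]
  simp [hφ]

/-- The conjugation moves inside the integral, where it is the substitution `U ↦ U V`. -/
theorem twirl_conj {n : ℕ} (Φ : SuperOp n) (V : Matrix.unitaryGroup (Fin n) ℂ) :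
    sandwich (V : Mat n)ᴴ (V : Mat n) * twirl Φ * sandwich (V : Mat n) (V : Mat n)ᴴ = twirl Φ := by
  have h : ∀ T : SuperOp n, ((ContinuousLinearMap.mul ℂ (SuperOp n)).flip
      (sandwich (V : Mat n) (V : Mat n)ᴴ) ∘L
      ContinuousLinearMap.mul ℂ (SuperOp n) (sandwich (V : Mat n)ᴴ (V : Mat n))) T =
      sandwich (V : Mat n)ᴴ (V : Mat n) * T * sandwich (V : Mat n) (V : Mat n)ᴴ := fun T => rfl
  rw [← h, twirl, ← ContinuousLinearMap.integral_comp_comm _ (integrable_twirlIntegrand Φ)]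
  conv_rhs => rw [← MeasureTheory.integral_mul_right_eq_self (μ := unitaryHaar n) _ V]
  congr 1
  ext1 U
  rw [h]
  simp only [Matrix.UnitaryGroup.mul_val, Matrix.conjTranspose_mul, ← sandwich_mul_sandwich, mul_assoc]

theorem twirl_comm_conjOp {n : ℕ} (Φ : SuperOp n) (V : Matrix.unitaryGroup (Fin n) ℂ) :
    twirl Φ * conjOp (V : Mat n) = conjOp (V : Mat n) * twirl Φ := by
  have h := congrArg (fun T => conjOp (V : Mat n) * T) (twirl_conj Φ V)
  simp only [conjOp, ← mul_assoc] at h ⊢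
  rw [sandwich_mul_sandwich, mul_conjTranspose_self_of_unitary, sandwich_one_one, one_mul] at h
  exact h

/-! ### The commutant of the unitary conjugations -/

theorem permMatrix_mem_unitaryGroup {n : ℕ} (σ : Equiv.Perm (Fin n)) :
    σ.permMatrix ℂ ∈ Matrix.unitaryGroup (Fin n) ℂ := by
  rw [Matrix.mem_unitaryGroup_iff, Matrix.star_eq_conjTranspose, Matrix.conjTranspose_permMatrix,
    ← Matrix.permMatrix_mul]
  simp

theorem conjOp_permMatrix {n : ℕ} (σ : Equiv.Perm (Fin n)) (X : Mat n) :
    conjOp (σ.permMatrix ℂ) X = X.submatrix σ σ := by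
  rw [conjOp_apply, Matrix.conjTranspose_permMatrix, Equiv.Perm.permMatrix, Equiv.Perm.permMatrix,
    PEquiv.toMatrix_toPEquiv_mul, PEquiv.mul_toMatrix_toPEquiv]
  rfl

theorem signDiagonal_mem_unitaryGroup {n : ℕ} (k : Fin n) :
    Matrix.diagonal (fun i => if i = k then (-1 : ℂ) else 1) ∈ Matrix.unitaryGroup (Fin n) ℂ := by
  rw [Matrix.mem_unitaryGroup_iff, Matrix.star_eq_conjTranspose, Matrix.diagonal_conjTranspose,
    Matrix.diagonal_mul_diagonal, ← Matrix.diagonal_one]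
  congr 1
  ext i
  by_cases h : i = k <;> simp [h]

section Commutant

variable {n : ℕ} {T : SuperOp n}

theorem apply_conjOp_of_comm
    (hT : ∀ V : Matrix.unitaryGroup (Fin n) ℂ, T * conjOp (V : Mat n) = conjOp (V : Mat n) * T)
    {U : Mat n} (hU : U ∈ Matrix.unitaryGroup (Fin n) ℂ) (X : Mat n) :
    T (conjOp U X) = conjOp U (T X) := by
  rw [← superOp_mul_apply, hT ⟨U, hU⟩, superOp_mul_apply]

theorem apply_submatrix_of_comm
    (hT : ∀ V : Matrix.unitaryGroup (Fin n) ℂ, T * conjOp (V : Mat n) = conjOp (V : Mat n) * T)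
    (σ : Equiv.Perm (Fin n)) (X : Mat n) : T (X.submatrix σ σ) = (T X).submatrix σ σ := by
  simpa only [conjOp_permMatrix] using
    apply_conjOp_of_comm hT (permMatrix_mem_unitaryGroup σ) X

theorem apply_single_perm_of_comm
    (hT : ∀ V : Matrix.unitaryGroup (Fin n) ℂ, T * conjOp (V : Mat n) = conjOp (V : Mat n) * T)
    (σ : Equiv.Perm (Fin n)) (i k : Fin n) :
    T (Matrix.single (σ i) (σ i) 1) (σ k) (σ k) = T (Matrix.single i i 1) k k := by
  have h := apply_submatrix_of_comm hT σ (Matrix.single (σ i) (σ i) 1)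
  rw [show (Matrix.single (σ i) (σ i) (1 : ℂ)).submatrix σ σ = Matrix.single i i 1 by
    ext a b; simp [Matrix.single_apply]] at h
  rw [h]; rfl

/-- Flipping the sign of the `k`-th basis vector fixes the diagonal matrix unit but negates the `(k,
l)` entry of its image. -/
theorem apply_single_offDiag_of_comm
    (hT : ∀ V : Matrix.unitaryGroup (Fin n) ℂ, T * conjOp (V : Mat n) = conjOp (V : Mat n) * T)
    (i : Fin n) {k l : Fin n} (hkl : k ≠ l) : T (Matrix.single i i 1) k l = 0 := by
  have h := congrFun (congrFun
    (apply_conjOp_of_comm hT (signDiagonal_mem_unitaryGroup k) (Matrix.single i i 1)) k) l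
  have hE : conjOp (Matrix.diagonal (fun i => if i = k then (-1 : ℂ) else 1))
      (Matrix.single i i 1) = Matrix.single i i 1 := by
    rw [conjOp_apply, Matrix.diagonal_conjTranspose]
    ext a b
    rw [Matrix.mul_diagonal, Matrix.diagonal_mul, Matrix.single_apply]
    by_cases h : i = k <;> by_cases h1 : i = a <;> by_cases h2 : i = b <;> simp_all
  rw [hE, conjOp_apply, Matrix.diagonal_conjTranspose, Matrix.mul_diagonal, Matrix.diagonal_mul] at h
  simp [hkl.symm] at h
  linear_combination (1 / 2 : ℂ) * h

/-- By linearity `T` kills diagonal matrices, by the spectral theorem and equivariance all Hermitian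
ones, and these span over `ℂ`. -/
theorem eq_zero_of_comm_of_single
    (hT : ∀ V : Matrix.unitaryGroup (Fin n) ℂ, T * conjOp (V : Mat n) = conjOp (V : Mat n) * T)
    (h0 : ∀ i, T (Matrix.single i i 1) = 0) : T = 0 := by
  have hdiag : ∀ d : Fin n → ℂ, T (Matrix.diagonal d) = 0 := by
    intro d
    have : Matrix.diagonal d = ∑ i, d i • Matrix.single i i (1 : ℂ) := by
      simp [Matrix.smul_single, Matrix.sum_single_eq_diagonal]
    simp only [this, map_sum, map_smul, h0, smul_zero, Finset.sum_const_zero]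
  have hherm : ∀ A : Mat n, A.IsHermitian → T A = 0 := by
    intro A hA
    have h := apply_conjOp_of_comm hT hA.eigenvectorUnitary.2
      (Matrix.diagonal (RCLike.ofReal ∘ hA.eigenvalues))
    have h2 := hA.spectral_theorem
    rw [Unitary.conjStarAlgAut_apply] at h2
    rw [hdiag, map_zero, conjOp_apply] at h
    rw [h2]
    exact h
  ext1 X
  rw [← realPart_add_I_smul_imaginaryPart X, map_add, map_smul,
    hherm _ (realPart X).2, hherm _ (imaginaryPart X).2]
  simp

/-- A superoperator commuting with all unitary conjugations is a combination of the identity and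
the completely depolarizing superoperator. -/
theorem exists_eq_smul_add_smul_fullDepol_of_comm (hn : 2 ≤ n)
    (hT : ∀ V : Matrix.unitaryGroup (Fin n) ℂ, T * conjOp (V : Mat n) = conjOp (V : Mat n) * T) :
    ∃ a b : ℂ, T = a • (1 : SuperOp n) + b • fullDepol n := by
  let z : Fin n := ⟨0, by omega⟩
  let o : Fin n := ⟨1, by omega⟩
  have hzo : z ≠ o := by simp [z, o]
  have hdiag : ∀ i, T (Matrix.single i i 1) i i = T (Matrix.single z z 1) z z := by
    intro i
    simpa using apply_single_perm_of_comm hT (Equiv.swap z i) z z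
  have hoff : ∀ i k, i ≠ k → T (Matrix.single i i 1) k k = T (Matrix.single z z 1) o o := by
    intro i k hik
    -- This permutation sends `z` to `i` and `o` to `k`: the second swap moves the image of `o` to
    -- `k` without disturbing `i`.
    have h := apply_single_perm_of_comm hT
      (Equiv.swap k (Equiv.swap z i o) * Equiv.swap z i) z o
    have hne : i ≠ Equiv.swap z i o := by
      intro h
      exact hzo ((Equiv.swap z i).injective (by rw [← h, Equiv.swap_apply_left]))
    simpa [Equiv.swap_apply_of_ne_of_ne hik hne] using h
  have hn0 : (n : ℂ) ≠ 0 := by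
    have : n ≠ 0 := by omega
    exact_mod_cast this
  set e := T (Matrix.single z z 1) o o
  set d := T (Matrix.single z z 1) z z
  -- On a diagonal matrix unit, `a • 1 + b • D` has diagonal entry `a + b/n` at its own index and
  -- `b/n` elsewhere; matching with `d` and `e` gives the witnesses.
  refine ⟨d - e, n * e, sub_eq_zero.1 (eq_zero_of_comm_of_single ?_ fun i => ?_)⟩
  · intro V
    have hD : fullDepol n * conjOp (V : Mat n) = conjOp (V : Mat n) * fullDepol n := by
      ext1 X
      simp only [superOp_mul_apply, fullDepol_apply, conjOp_apply]
      rw [Matrix.trace_mul_comm, ← mul_assoc, conjTranspose_mul_self_of_unitary]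
      simp [mul_conjTranspose_self_of_unitary]
    simp only [sub_mul, mul_sub, add_mul, mul_add, smul_mul_assoc, mul_smul_comm, hT V, hD,
      one_mul, mul_one]
  · ext k l
    by_cases hkl : k = l
    · subst hkl
      by_cases hik : i = k
      · subst hik
        simp [fullDepol_apply, hdiag]
        field_simp
        ring
      · simp [fullDepol_apply, hoff i k hik, hik]
        field_simp
        ring
    · simp [apply_single_offDiag_of_comm hT i hkl, fullDepol_apply, hkl, Matrix.single_apply]
      rintro rfl h
      exact absurd h hkl
end Commutant

/-! ### Two twirl-invariant functionals and the closed form of the twirl -/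

/-- The trace of a superoperator, as a continuous functional. -/
noncomputable def superTrace (n : ℕ) : SuperOp n →L[ℂ] ℂ :=
  LinearMap.toContinuousLinearMap
    (LinearMap.trace ℂ (Mat n) ∘ₗ ContinuousLinearMap.coeLM ℂ)

theorem superTrace_apply {n : ℕ} (Φ : SuperOp n) :
    superTrace n Φ = LinearMap.trace ℂ (Mat n) (Φ : Mat n →ₗ[ℂ] Mat n) := rfl

theorem superTrace_mul_comm {n : ℕ} (Φ Ψ : SuperOp n) :
    superTrace n (Φ * Ψ) = superTrace n (Ψ * Φ) :=
  LinearMap.trace_mul_comm ℂ (Φ : Mat n →ₗ[ℂ] Mat n) (Ψ : Mat n →ₗ[ℂ] Mat n)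

theorem superTrace_eq_sum {n : ℕ} (Φ : SuperOp n) :
    superTrace n Φ = ∑ i, ∑ j, Φ (Matrix.single i j 1) i j := by
  rw [superTrace_apply, LinearMap.trace_eq_matrix_trace ℂ (Matrix.stdBasis ℂ (Fin n) (Fin n)),
    Matrix.trace, Fintype.sum_prod_type]
  refine Finset.sum_congr rfl fun i _ => Finset.sum_congr rfl fun j _ => ?_
  rw [Matrix.diag_apply, LinearMap.toMatrix_apply, Matrix.stdBasis_eq_single]
  rfl

theorem superTrace_sandwich {n : ℕ} (A B : Mat n) :
    superTrace n (sandwich A B) = A.trace * B.trace := by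
  rw [superTrace_eq_sum, Matrix.trace, Matrix.trace, Finset.sum_mul_sum]
  refine Finset.sum_congr rfl fun i _ => Finset.sum_congr rfl fun j _ => ?_
  rw [sandwich_apply, Matrix.mul_apply, Finset.sum_eq_single j]
  · simp
  · intro k _ hk
    simp [hk]
  · simp

theorem superTrace_one {n : ℕ} : superTrace n 1 = (n : ℂ) ^ 2 := by
  rw [← sandwich_one_one, superTrace_sandwich]
  simp [sq]

theorem superTrace_fullDepol {n : ℕ} (hn : n ≠ 0) : superTrace n (fullDepol n) = 1 := by
  have : (n : ℂ) ≠ 0 := by exact_mod_cast hn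
  rw [superTrace_eq_sum]
  simp only [fullDepol_apply, Matrix.smul_apply, Matrix.one_apply, smul_eq_mul]
  rw [Finset.sum_congr rfl fun i _ => Finset.sum_eq_single i (by
    intro j _ hj; simp [hj.symm]) (by simp)]
  simp [this]

/-- The functional `Φ ↦ Tr Φ(I) / n`. -/
noncomputable def unitTrace (n : ℕ) : SuperOp n →L[ℂ] ℂ :=
  LinearMap.toContinuousLinearMap
    ((n : ℂ)⁻¹ • (Matrix.traceLinearMap (Fin n) ℂ ℂ ∘ₗ LinearMap.applyₗ (1 : Mat n) ∘ₗ
      ContinuousLinearMap.coeLM ℂ))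

theorem unitTrace_apply {n : ℕ} (Φ : SuperOp n) :
    unitTrace n Φ = (n : ℂ)⁻¹ * (Φ 1).trace := rfl

theorem unitTrace_one {n : ℕ} (hn : n ≠ 0) : unitTrace n 1 = 1 := by
  have : (n : ℂ) ≠ 0 := by exact_mod_cast hn
  simp [unitTrace_apply, this]

theorem unitTrace_fullDepol {n : ℕ} (hn : n ≠ 0) : unitTrace n (fullDepol n) = 1 := by
  have : (n : ℂ) ≠ 0 := by exact_mod_cast hn
  simp [unitTrace_apply, fullDepol_apply, this]

theorem superTrace_twirl {n : ℕ} (Φ : SuperOp n) : superTrace n (twirl Φ) = superTrace n Φ := by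
  refine map_twirl _ (fun U Ψ => ?_) Φ
  rw [superTrace_mul_comm, ← mul_assoc, sandwich_mul_sandwich, mul_conjTranspose_self_of_unitary,
    sandwich_one_one, one_mul]

theorem unitTrace_twirl {n : ℕ} (Φ : SuperOp n) : unitTrace n (twirl Φ) = unitTrace n Φ := by
  refine map_twirl _ (fun U Ψ => ?_) Φ
  rw [unitTrace_apply, unitTrace_apply, superOp_mul_apply, superOp_mul_apply, sandwich_apply,
    sandwich_apply, mul_one, mul_conjTranspose_self_of_unitary, Matrix.trace_mul_comm, ← mul_assoc,
    mul_conjTranspose_self_of_unitary, one_mul]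

/-- The coefficient of `1 - fullDepol n` in the twirl of a superoperator. -/
noncomputable def twirlCoeff (n : ℕ) : SuperOp n →L[ℂ] ℂ :=
  ((n : ℂ) ^ 2 - 1)⁻¹ • (superTrace n - unitTrace n)

theorem twirlCoeff_apply {n : ℕ} (Φ : SuperOp n) :
    twirlCoeff n Φ = ((n : ℂ) ^ 2 - 1)⁻¹ * (superTrace n Φ - unitTrace n Φ) := rfl

theorem natCast_sq_sub_one_ne_zero {n : ℕ} (hn : 2 ≤ n) : (n : ℂ) ^ 2 - 1 ≠ 0 := by
  intro h
  have h2 : ((n ^ 2 : ℕ) : ℂ) = ((1 : ℕ) : ℂ) := by push_cast; linear_combination h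
  have h3 : n ^ 2 = 1 := by exact_mod_cast h2
  nlinarith

theorem twirlCoeff_one {n : ℕ} (hn : 2 ≤ n) : twirlCoeff n 1 = 1 := by
  rw [twirlCoeff_apply, superTrace_one, unitTrace_one (by omega),
    inv_mul_cancel₀ (natCast_sq_sub_one_ne_zero hn)]

theorem twirlCoeff_fullDepol {n : ℕ} (hn : 2 ≤ n) : twirlCoeff n (fullDepol n) = 0 := by
  rw [twirlCoeff_apply, superTrace_fullDepol (by omega), unitTrace_fullDepol (by omega)]
  simp

/-- The twirl of a superoperator in closed form. -/
theorem twirl_eq {n : ℕ} (hn : 2 ≤ n) (Φ : SuperOp n) :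
    twirl Φ = twirlCoeff n Φ • (1 - fullDepol n) + unitTrace n Φ • fullDepol n := by
  obtain ⟨a, b, h⟩ := exists_eq_smul_add_smul_fullDepol_of_comm hn (twirl_comm_conjOp Φ)
  -- `twirlCoeff` takes the values `1, 0` on `1, D`, and `unitTrace` the values `1, 1`, so together
  -- they determine `a` and `b`.
  have h1 : twirlCoeff n (twirl Φ) = a := by
    rw [h, map_add, map_smul, map_smul, twirlCoeff_one hn, twirlCoeff_fullDepol hn]
    simp
  have h2 : unitTrace n (twirl Φ) = a + b := by
    rw [h, map_add, map_smul, map_smul, unitTrace_one (by omega), unitTrace_fullDepol (by omega)]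
    simp
  have h3 : twirlCoeff n (twirl Φ) = twirlCoeff n Φ := by
    rw [twirlCoeff_apply, twirlCoeff_apply, superTrace_twirl, unitTrace_twirl]
  rw [unitTrace_twirl] at h2
  rw [h, h2, ← h3, h1]
  module

theorem twirl_eq_of_unitTrace_eq_zero {n : ℕ} (hn : 2 ≤ n) {Φ : SuperOp n}
    (h : unitTrace n Φ = 0) : twirl Φ = twirlCoeff n Φ • (1 - fullDepol n) := by
  rw [twirl_eq hn, h, zero_smul, add_zero]

theorem fullDepol_mul_fullDepol {n : ℕ} (hn : n ≠ 0) :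
    fullDepol n * fullDepol n = fullDepol n := by
  have : (n : ℂ) ≠ 0 := by exact_mod_cast hn
  ext1 X
  rw [superOp_mul_apply, fullDepol_apply, fullDepol_apply]
  simp [this]

theorem one_sub_fullDepol_mul_self {n : ℕ} (hn : n ≠ 0) :
    (1 - fullDepol n) * (1 - fullDepol n) = 1 - fullDepol n := by
  simp [sub_mul, mul_sub, fullDepol_mul_fullDepol hn]

/-- `D` preserves the trace, so composing with it on the left leaves `unitTrace` unchanged. -/
theorem unitTrace_eq_zero_of_fullDepol_mul {n : ℕ} (hn : n ≠ 0) {Φ : SuperOp n}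
    (h : fullDepol n * Φ = 0) : unitTrace n Φ = 0 := by
  have h1 : unitTrace n (fullDepol n * Φ) = unitTrace n Φ := by
    have : (n : ℂ) ≠ 0 := by exact_mod_cast hn
    rw [unitTrace_apply, unitTrace_apply, superOp_mul_apply, fullDepol_apply]
    simp [this]
  rw [← h1, h, map_zero]

/-- From `D Φ D = unitTrace n Φ • D` and cyclicity, both functionals agree on `Φ D`. This permits
replacing `Φ` by `Φ Q` under the twirl, even when `Φ` is not unital. -/
theorem twirlCoeff_mul_fullDepol {n : ℕ} (hn : n ≠ 0) (Φ : SuperOp n) :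
    twirlCoeff n (Φ * fullDepol n) = 0 := by
  have h0 : (n : ℂ) ≠ 0 := by exact_mod_cast hn
  have h1 : fullDepol n * Φ * fullDepol n = unitTrace n Φ • fullDepol n := by
    ext1 X
    simp only [superOp_mul_apply, fullDepol_apply, map_smul, smul_apply,
      unitTrace_apply, smul_smul]
    congr 1
    ring
  have h2 : superTrace n (Φ * fullDepol n) = unitTrace n Φ := by
    rw [← fullDepol_mul_fullDepol hn, ← mul_assoc, superTrace_mul_comm, ← mul_assoc, h1, map_smul,
      superTrace_fullDepol hn, smul_eq_mul, mul_one]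
  have h3 : unitTrace n (Φ * fullDepol n) = unitTrace n Φ := by
    rw [unitTrace_apply, unitTrace_apply, superOp_mul_apply, fullDepol_apply]
    simp [h0]
  rw [twirlCoeff_apply, h2, h3, sub_self, mul_zero]

theorem freeGenerator_eq (n : ℕ) (γ p : ℝ) :
    freeGenerator n γ p = -((γ * (1 - p) : ℂ) • (1 - fullDepol n)) := by
  rw [freeGenerator, depolarizing]
  module

/-! ### Traces of the GKSL generator and the second-order rate -/

section Gksl

variable {n : ℕ} {J : Type*} [Fintype J] (H : Mat n) (L : J → Mat n)

/-- In this form products are again sums of sandwiches, whose traces factorize. -/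
theorem gksl_eq : gksl H L =
    sandwich (-(Complex.I • H) - (1 / 2 : ℂ) • jumpSum L) 1
      + sandwich 1 (Complex.I • H - (1 / 2 : ℂ) • jumpSum L)
      + ∑ j, sandwich (L j) (L j)ᴴ := by
  ext1 X
  simp only [gksl, jumpSum, add_apply, smul_apply,
    sub_apply, sum_apply, sandwich_apply, mul_one, one_mul,
    Finset.sum_sub_distrib, ← Finset.smul_sum, Finset.sum_add_distrib, Finset.sum_mul,
    Finset.mul_sum, sub_mul, mul_sub, neg_mul, smul_mul_assoc, mul_smul_comm]
  module

theorem trace_gksl_apply (X : Mat n) : (gksl H L X).trace = 0 := by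
  simp only [gksl_eq, add_apply, sum_apply, sandwich_apply,
    Matrix.trace_add, Matrix.trace_sum, mul_one, one_mul]
  rw [Matrix.trace_mul_comm X]
  have h : ∀ j, (L j * X * (L j)ᴴ).trace = ((L j)ᴴ * L j * X).trace := fun j => by
    rw [Matrix.trace_mul_comm, mul_assoc]
  simp only [h, ← Matrix.trace_sum, ← Finset.sum_mul]
  rw [← jumpSum]
  rw [← Matrix.trace_add, ← Matrix.trace_add, ← add_mul, ← add_mul]
  convert Matrix.trace_zero (Fin n) ℂ
  rw [show -(Complex.I • H) - (1 / 2 : ℂ) • jumpSum L + (Complex.I • H - (1 / 2 : ℂ) • jumpSum L)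
    + jumpSum L = 0 by module, zero_mul]

theorem fullDepol_mul_gksl : fullDepol n * gksl H L = 0 := by
  ext1 X
  rw [superOp_mul_apply, fullDepol_apply, trace_gksl_apply, zero_smul]
  rfl

variable {L}

theorem superTrace_gksl (hL : ∀ j, (L j).trace = 0) :
    superTrace n (gksl H L) = -(n * (jumpSum L).trace) := by
  rw [gksl_eq]
  simp only [map_add, map_sum, superTrace_sandwich, hL, zero_mul, Finset.sum_const_zero,
    Matrix.trace_sub, Matrix.trace_neg, Matrix.trace_smul, Matrix.trace_one, Fintype.card_fin,
    smul_eq_mul]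
  ring

/-- Every cross term between the drift and a jump carries a factor `Tr (L j)` or `Tr (L j)ᴴ` and
vanishes; the jump-jump terms give the squared moduli. -/
theorem superTrace_gksl_mul_gksl (hL : ∀ j, (L j).trace = 0) :
    superTrace n (gksl H L * gksl H L) =
      n * (-2 * (H ^ 2).trace + 1 / 2 * (jumpSum L ^ 2).trace) + 2 * H.trace ^ 2
        + 1 / 2 * (jumpSum L).trace ^ 2 + ∑ j, ∑ k, (‖(L j * L k).trace‖ : ℂ) ^ 2 := by
  have hL' : ∀ j, ((L j)ᴴ).trace = 0 := fun j => by rw [Matrix.trace_conjTranspose, hL, star_zero]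
  have hLL : ∀ j k, (L j * L k).trace * ((L k)ᴴ * (L j)ᴴ).trace = (‖(L j * L k).trace‖ : ℂ) ^ 2 :=
    fun j k => by
      rw [← Matrix.conjTranspose_mul, Matrix.trace_conjTranspose]
      exact Complex.mul_conj' _
  rw [gksl_eq, Finset.sum_comm]
  generalize jumpSum L = G
  simp only [mul_add, add_mul, Finset.mul_sum, Finset.sum_mul, map_add, map_sum,
    sandwich_mul_sandwich, superTrace_sandwich, mul_one, one_mul, hL, hL', hLL, zero_mul, mul_zero,
    Finset.sum_const_zero, add_zero, zero_add, Matrix.trace_one, Fintype.card_fin]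
  simp only [sub_mul, mul_sub, neg_mul, mul_neg, smul_mul_assoc, mul_smul_comm, Matrix.trace_sub,
    Matrix.trace_neg, Matrix.trace_smul, smul_eq_mul, Matrix.trace_mul_comm G H, sq H, sq G]
  linear_combination (2 * n * (H * H).trace - 2 * H.trace ^ 2) * Complex.I_sq

theorem avg_def (A : Mat n) : avg A = (n : ℂ)⁻¹ * A.trace := rfl

variable {H}

/-- The depolarization rate in terms of the twirl coefficients of the perturbation. -/
theorem depolRate_eq (hn : 2 ≤ n) (γ p : ℝ) (hL : ∀ j, (L j).trace = 0) (t₀ t lam : ℝ) :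
    depolRate γ p H L t₀ t lam = γ * (1 - p) - lam * twirlCoeff n (gksl H L)
      - lam ^ 2 * (t - t₀) *
        (twirlCoeff n (gksl H L * gksl H L) - twirlCoeff n (gksl H L) ^ 2) := by
  have h0 : (n : ℂ) ≠ 0 := by
    have : n ≠ 0 := by omega
    exact_mod_cast this
  have h1 := natCast_sq_sub_one_ne_zero hn
  -- With both `unitTrace` terms zero, `twirlCoeff` is the superoperator trace over `n² - 1`.
  have hu : unitTrace n (gksl H L) = 0 :=
    unitTrace_eq_zero_of_fullDepol_mul (by omega) (fullDepol_mul_gksl H L)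
  have hu2 : unitTrace n (gksl H L * gksl H L) = 0 :=
    unitTrace_eq_zero_of_fullDepol_mul (by omega)
      (by rw [← mul_assoc, fullDepol_mul_gksl, zero_mul])
  have hS : ∑ j, ∑ k, ((‖avg (L j * L k)‖ : ℂ)) ^ 2 =
      ((n : ℂ) ^ 2)⁻¹ * ∑ j, ∑ k, (‖(L j * L k).trace‖ : ℂ) ^ 2 := by
    simp only [Finset.mul_sum, avg_def, norm_mul, norm_inv, Complex.norm_natCast]
    refine Finset.sum_congr rfl fun j _ => Finset.sum_congr rfl fun k _ => ?_
    push_cast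
    ring
  rw [depolRate, twirlCoeff_apply, twirlCoeff_apply, hu, hu2, superTrace_gksl H hL,
    superTrace_gksl_mul_gksl H hL, hS]
  simp only [avg_def]
  field_simp
  ring

/-- The second-order generator is a multiple of the depolarizing generator. -/
theorem secondOrderGenerator_eq (hn : 2 ≤ n) (γ p : ℝ) (hL : ∀ j, (L j).trace = 0)
    (t₀ t lam : ℝ) :
    freeGenerator n γ p + (lam : ℂ) • twirl (gksl H L)
        + ((lam : ℂ) ^ 2 * ((t : ℂ) - (t₀ : ℂ))) •
          (twirl (gksl H L * gksl H L) - twirl (gksl H L) * twirl (gksl H L))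
      = -(depolRate γ p H L t₀ t lam • (1 - fullDepol n)) := by
  rw [twirl_eq_of_unitTrace_eq_zero hn (unitTrace_eq_zero_of_fullDepol_mul (by omega)
      (fullDepol_mul_gksl H L)),
    twirl_eq_of_unitTrace_eq_zero hn (unitTrace_eq_zero_of_fullDepol_mul (by omega)
      (show fullDepol n * (gksl H L * gksl H L) = 0 by
        rw [← mul_assoc, fullDepol_mul_gksl, zero_mul])),
    smul_mul_smul_comm, one_sub_fullDepol_mul_self (by omega), freeGenerator_eq,
    depolRate_eq hn γ p hL]
  module

end Gksl

open Asymptotics Filter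

/-! ### Expansion of the twirl coefficient of the exponential flow -/

section ExpExpansion

variable {n : ℕ} (M : SuperOp n)

theorem exp_smul_sub_linear_isBigO :
    (fun x : ℝ => NormedSpace.exp (x • M) - (1 + x • M)) =O[𝓝 0] fun x => x ^ 2 := by
  have h := (NormedSpace.hasFPowerSeriesAt_exp_zero_of_radius_pos
    (NormedSpace.expSeries_radius_pos ℝ (SuperOp n))).isBigO_sub_partialSum_pow 2
  have hx : Tendsto (fun x : ℝ => x • M) (𝓝 0) (𝓝 0) :=
    (by fun_prop : Continuous fun x : ℝ => x • M).tendsto' _ _ (zero_smul _ _)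
  have h2 := h.comp_tendsto hx
  have h3 : (fun x : ℝ => NormedSpace.exp (x • M) - (1 + x • M)) =
      (fun y : SuperOp n => NormedSpace.exp (0 + y) -
        (NormedSpace.expSeries ℝ (SuperOp n)).partialSum 2 y) ∘ fun x : ℝ => x • M := by
    ext1 x
    simp [FormalMultilinearSeries.partialSum, Finset.sum_range_succ,
      NormedSpace.expSeries_apply_eq]
  rw [h3]
  refine h2.trans (IsBigO.of_bound (‖M‖ ^ 2) (Eventually.of_forall fun x => ?_))
  simp [norm_smul, mul_pow, mul_comm]

theorem functional_exp_smul_isBigO (φ : SuperOp n →L[ℂ] ℂ) :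
    (fun x : ℝ => φ (NormedSpace.exp (x • M)) - (φ 1 + x * φ M)) =O[𝓝 0] fun x => x ^ 2 := by
  refine ((φ.isBigO_comp _ _).trans (exp_smul_sub_linear_isBigO M)).congr_left fun x => ?_
  rw [map_sub, map_add, ← Complex.coe_smul, map_smul, smul_eq_mul]

/-- The twirl coefficient of the flow generated by `M`. -/
noncomputable def flowCoeff (x : ℝ) : ℂ := twirlCoeff n (NormedSpace.exp (x • M))

/-- The derivative of `flowCoeff`. -/
noncomputable def flowCoeffDeriv (x : ℝ) : ℂ := twirlCoeff n (M * NormedSpace.exp (x • M))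

theorem hasDerivAt_exp_real_smul (x : ℝ) :
    HasDerivAt (fun u : ℝ => NormedSpace.exp (u • M)) (M * NormedSpace.exp (x • M)) x :=
  hasDerivAt_exp_smul_const' (𝕂 := ℝ) M x

theorem hasDerivAt_functional (φ : SuperOp n →L[ℂ] ℂ) {f : ℝ → SuperOp n} {f' : SuperOp n} {x : ℝ}
    (h : HasDerivAt f f' x) : HasDerivAt (fun u => φ (f u)) (φ f') x :=
  (φ.restrictScalars ℝ).hasFDerivAt.comp_hasDerivAt x h

theorem hasDerivAt_flowCoeff (x : ℝ) : HasDerivAt (flowCoeff M) (flowCoeffDeriv M x) x :=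
  hasDerivAt_functional _ (hasDerivAt_exp_real_smul M x)

theorem flowCoeff_zero (hn : 2 ≤ n) : flowCoeff M 0 = 1 := by
  rw [flowCoeff, zero_smul, NormedSpace.exp_zero, twirlCoeff_one hn]

theorem eventually_flowCoeff_ne_zero (hn : 2 ≤ n) : ∀ᶠ x in 𝓝 0, flowCoeff M x ≠ 0 :=
  (hasDerivAt_flowCoeff M 0).continuousAt.eventually_ne (by simp [flowCoeff_zero M hn])

/-- Second-order expansion of the logarithmic derivative of `flowCoeff`. -/
theorem flowCoeff_logDeriv_isBigO (hn : 2 ≤ n) :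
    (fun x : ℝ => flowCoeffDeriv M x / flowCoeff M x -
      (twirlCoeff n M + x * (twirlCoeff n (M * M) - twirlCoeff n M ^ 2)))
      =O[𝓝 0] fun x => x ^ 2 := by
  have hu := functional_exp_smul_isBigO M (twirlCoeff n)
  -- The derivative is the functional `Ψ ↦ twirlCoeff n (M Ψ)` evaluated on the same exponential, so
  -- the same expansion applies.
  have hv := functional_exp_smul_isBigO M (twirlCoeff n ∘L ContinuousLinearMap.mul ℂ _ M)
  simp only [ContinuousLinearMap.comp_apply, ContinuousLinearMap.mul_apply', mul_one,
    twirlCoeff_one hn] at hu hv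
  have hc : ContinuousAt (fun x : ℝ => (flowCoeff M x)⁻¹) 0 :=
    (hasDerivAt_flowCoeff M 0).continuousAt.inv₀ (by simp [flowCoeff_zero M hn])
  have hi : (fun x : ℝ => (flowCoeff M x)⁻¹) =O[𝓝 0] fun _ => (1 : ℝ) :=
    hc.isBigO_one ℝ
  set a := twirlCoeff n M
  set b := twirlCoeff n (M * M)
  have hl : (fun x : ℝ => a + x * (b - a ^ 2)) =O[𝓝 0] fun _ => (1 : ℝ) :=
    (by fun_prop : Continuous fun x : ℝ => a + x * (b - a ^ 2)).continuousAt.isBigO_one ℝ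
  have hq : (fun x : ℝ => (x : ℂ) ^ 2 * (a * (b - a ^ 2))) =O[𝓝 0] fun x => x ^ 2 :=
    IsBigO.of_bound ‖a * (b - a ^ 2)‖ (Eventually.of_forall fun x => by simp [mul_comm])
  -- This bounds `f' - (a + x(b - a²)) f`, because `(a + x(b - a²))(1 + xa) = a + xb + x² a(b -
  -- a²)`; `hq` absorbs the last term.
  have hnum := (hv.sub hq).sub ((hl.mul hu).congr_right fun x => by rw [one_mul])
  refine ((hnum.mul hi).congr_right fun x => by rw [mul_one]).congr' ?_ EventuallyEq.rfl
  filter_upwards [eventually_flowCoeff_ne_zero M hn] with x hx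
  rw [← flowCoeffDeriv, ← flowCoeff]
  field_simp
  ring

end ExpExpansion

/-! ### Exact projected dynamics and its generator -/

section Propagator

variable {n : ℕ} {M : SuperOp n}

theorem fullDepol_mul_exp_smul (hM : fullDepol n * M = 0) (x : ℝ) :
    fullDepol n * NormedSpace.exp (x • M) = fullDepol n := by
  have h : ∀ u : ℝ, HasDerivAt (fun u : ℝ => fullDepol n * NormedSpace.exp (u • M)) 0 u := by
    intro u
    have := (hasDerivAt_exp_real_smul M u).const_mul (fullDepol n)
    rwa [← mul_assoc, hM, zero_mul] at this
  have := is_const_of_deriv_eq_zero (fun u => (h u).differentiableAt) (fun u => (h u).deriv) x 0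
  simpa using this

theorem IsPropagator.unitTrace_eq_one (hn : n ≠ 0) (hM : fullDepol n * M = 0) {t₀ : ℝ}
    {Φ : ℝ → SuperOp n} (hΦ : IsPropagator M t₀ Φ) (s : ℝ) : unitTrace n (Φ s) = 1 := by
  have h : ∀ u : ℝ, HasDerivAt (fun u : ℝ => unitTrace n (Φ u)) 0 u := by
    intro u
    have := hasDerivAt_functional (unitTrace n) (hΦ.2 u)
    rwa [unitTrace_eq_zero_of_fullDepol_mul hn (by rw [← mul_assoc, hM, zero_mul])] at this
  have := is_const_of_deriv_eq_zero (fun u => (h u).differentiableAt) (fun u => (h u).deriv) s t₀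
  simpa [hΦ.1, unitTrace_one hn] using this

theorem eq_of_hasDerivAt_mul {M : SuperOp n} {t₀ : ℝ} {Y Z : ℝ → SuperOp n}
    (hY : ∀ s, HasDerivAt Y (M * Y s) s) (hZ : ∀ s, HasDerivAt Z (M * Z s) s)
    (h0 : Y t₀ = Z t₀) : Y = Z :=
  ODE_solution_unique_univ (v := fun _ X => M * X) (s := fun _ => Set.univ) (K := ‖M‖₊)
    (fun _ => LipschitzWith.lipschitzOnWith
      (LipschitzWith.of_dist_le_mul fun X X' => by
        rw [dist_eq_norm, dist_eq_norm, ← mul_sub]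
        exact norm_mul_le _ _))
    (fun s => ⟨hY s, trivial⟩) (fun s => ⟨hZ s, trivial⟩) h0

variable {c : ℂ} {lam t₀ : ℝ} {Φ : ℝ → SuperOp n}

theorem hasDerivAt_exp_decay (c : ℂ) (t₀ s : ℝ) :
    HasDerivAt (fun s : ℝ => Complex.exp (-(c * (s - t₀)))) (Complex.exp (-(c * (s - t₀))) * -c) s := by
  have h : HasDerivAt (fun s : ℝ => -(c * ((s : ℂ) - t₀))) (-c) s := by
    simpa using (((hasDerivAt_id s).ofReal_comp.sub_const (t₀ : ℂ)).const_mul c).fun_neg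
  exact h.cexp

/-- Both sides solve the same linear equation with the same initial value. -/
theorem IsPropagator.mul_one_sub_fullDepol (hn : n ≠ 0) (hM : fullDepol n * M = 0)
    (hΦ : IsPropagator (-(c • (1 - fullDepol n)) + (lam : ℂ) • M) t₀ Φ) (s : ℝ) :
    Φ s * (1 - fullDepol n) = Complex.exp (-(c * (s - t₀))) •
      (NormedSpace.exp (((s - t₀) * lam) • M) * (1 - fullDepol n)) := by
  refine congrFun (eq_of_hasDerivAt_mul (t₀ := t₀)
    (M := -(c • (1 - fullDepol n)) + (lam : ℂ) • M)
    (Y := fun s => Φ s * (1 - fullDepol n))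
    (Z := fun s => Complex.exp (-(c * (s - t₀))) •
      (NormedSpace.exp (((s - t₀) * lam) • M) * (1 - fullDepol n))) (fun s => ?_) (fun s => ?_) ?_) s
  · simpa only [mul_assoc] using (hΦ.2 s).mul_const (1 - fullDepol n)
  · have h1 : HasDerivAt (fun s : ℝ => (s - t₀) * lam) lam s := by
      simpa using ((hasDerivAt_id s).sub_const t₀).mul_const lam
    have h2 := ((hasDerivAt_exp_real_smul M ((s - t₀) * lam)).scomp s h1).mul_const
      (1 - fullDepol n)
    have h3 := (hasDerivAt_exp_decay c t₀ s).smul h2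
    refine h3.congr_deriv ?_
    -- The flow preserves the trace, so its values on traceless matrices stay traceless and the free
    -- part acts on them as the scalar `-c`; `M` and `D` need not commute.
    have hD : fullDepol n * (NormedSpace.exp (((s - t₀) * lam) • M) * (1 - fullDepol n)) = 0 := by
      rw [← mul_assoc, fullDepol_mul_exp_smul hM, mul_sub, mul_one, fullDepol_mul_fullDepol hn,
        sub_self]
    generalize hE : NormedSpace.exp (((s - t₀) * lam) • M) = E at hD ⊢
    have hM' : (-(c • (1 - fullDepol n)) + (lam : ℂ) • M) * (E * (1 - fullDepol n)) =
        -(c • (E * (1 - fullDepol n))) + (lam : ℂ) • (M * E * (1 - fullDepol n)) := by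
      rw [add_mul, neg_mul, smul_mul_assoc, sub_mul, hD, one_mul, sub_zero, smul_mul_assoc,
        mul_assoc M]
    simp only [Function.comp_apply, hE]
    rw [mul_smul_comm, hM', smul_mul_assoc, ← Complex.coe_smul lam]
    module
  · simp [hΦ.1]

theorem IsPropagator.twirl_eq (hn : 2 ≤ n) (hM : fullDepol n * M = 0)
    (hΦ : IsPropagator (-(c • (1 - fullDepol n)) + (lam : ℂ) • M) t₀ Φ) (s : ℝ) :
    twirl (Φ s) = (Complex.exp (-(c * (s - t₀))) * flowCoeff M ((s - t₀) * lam)) •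
      (1 - fullDepol n) + fullDepol n := by
  have hn0 : n ≠ 0 := by omega
  have hQ : ∀ Ψ : SuperOp n, twirlCoeff n (Ψ * (1 - fullDepol n)) = twirlCoeff n Ψ := fun Ψ => by
    rw [mul_sub, mul_one, map_sub, twirlCoeff_mul_fullDepol hn0, sub_zero]
  have h1 : fullDepol n * (-(c • (1 - fullDepol n)) + (lam : ℂ) • M) = 0 := by
    rw [mul_add, mul_neg, mul_smul_comm, mul_smul_comm, hM, mul_sub, fullDepol_mul_fullDepol hn0]
    simp
  rw [_root_.twirl_eq hn, hΦ.unitTrace_eq_one hn0 h1, one_smul, ← hQ,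
    hΦ.mul_one_sub_fullDepol hn0 hM, map_smul, hQ, smul_eq_mul, flowCoeff]

theorem IsPropagator.isProjectedGenerator_iff (hn : 2 ≤ n) (hM : fullDepol n * M = 0)
    (hΦ : IsPropagator (-(c • (1 - fullDepol n)) + (lam : ℂ) • M) t₀ Φ) {s : ℝ}
    (hs : flowCoeff M ((s - t₀) * lam) ≠ 0) (K : SuperOp n) :
    IsProjectedGenerator Φ s K ↔
      K = (-c + lam * (flowCoeffDeriv M ((s - t₀) * lam) / flowCoeff M ((s - t₀) * lam))) •
        (1 - fullDepol n) := by
  have hn0 : n ≠ 0 := by omega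
  have h1 : HasDerivAt (fun s : ℝ => (s - t₀) * lam) lam s := by
    simpa using ((hasDerivAt_id s).sub_const t₀).mul_const lam
  have h2 := (((hasDerivAt_exp_decay c t₀ s).mul
    ((hasDerivAt_flowCoeff M _).scomp s h1)).smul_const (1 - fullDepol n)).add_const (fullDepol n)
  have hf : (fun s => twirl (Φ s)) = fun s : ℝ =>
      (Complex.exp (-(c * (s - t₀))) * flowCoeff M ((s - t₀) * lam)) •
        (1 - fullDepol n) + fullDepol n := funext (hΦ.twirl_eq hn hM)
  rw [IsProjectedGenerator, hf, hΦ.twirl_eq hn hM]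
  set e := Complex.exp (-(c * (s - t₀)))
  have he0 : e ≠ 0 := Complex.exp_ne_zero _
  set g := flowCoeff M ((s - t₀) * lam) with hg
  set g' := flowCoeffDeriv M ((s - t₀) * lam)
  have hDD := fullDepol_mul_fullDepol hn0
  have hQQ := one_sub_fullDepol_mul_self hn0
  have hQD : (1 - fullDepol n) * fullDepol n = 0 := by rw [sub_mul, hDD, one_mul, sub_self]
  have hDQ : fullDepol n * (1 - fullDepol n) = 0 := by rw [mul_sub, hDD, mul_one, sub_self]
  have h3 : HasDerivAt (fun s : ℝ =>
      (Complex.exp (-(c * (s - t₀))) * flowCoeff M ((s - t₀) * lam)) •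
        (1 - fullDepol n) + fullDepol n)
      ((((-c + lam * (g' / g)) • (1 - fullDepol n)) *
        ((e * g) • (1 - fullDepol n) + fullDepol n))) s := by
    refine h2.congr_deriv ?_
    rw [mul_add, smul_mul_smul_comm, smul_mul_assoc, hQQ, hQD, smul_zero, add_zero]
    congr 1
    rw [Complex.real_smul, Function.comp_apply, ← hg]
    field_simp
  constructor
  · intro h
    have h4 := congrArg (fun S => S * ((e * g)⁻¹ • (1 - fullDepol n) + fullDepol n)) (h.unique h3)
    -- `Q` and `D` are complementary idempotents, so inverting the coefficient of `Q` inverts the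
    -- projected dynamics; this forces uniqueness of `K`.
    have h5 : ((e * g) • (1 - fullDepol n) + fullDepol n) *
        ((e * g)⁻¹ • (1 - fullDepol n) + fullDepol n) = 1 := by
      rw [mul_add, add_mul, add_mul, smul_mul_smul_comm, hQQ, smul_mul_assoc, hQD, mul_smul_comm,
        hDQ, hDD, mul_inv_cancel₀ (mul_ne_zero he0 hs)]
      module
    simpa only [mul_assoc, h5, mul_one] using h4
  · rintro rfl
    exact h3

/-- The bound `|s - t₀| ≤ |t - t₀|` makes smallness of `lam` uniform in `s`. -/
theorem eventually_forall_uIcc_flowCoeff_ne_zero (hn : 2 ≤ n) (M : SuperOp n) (t₀ t : ℝ) :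
    ∀ᶠ lam : ℝ in 𝓝 0, ∀ s ∈ Set.uIcc t₀ t, flowCoeff M ((s - t₀) * lam) ≠ 0 := by
  obtain ⟨ε, hε, h⟩ := Metric.eventually_nhds_iff.1 (eventually_flowCoeff_ne_zero M hn)
  have hc : Tendsto (fun lam : ℝ => |t - t₀| * |lam|) (𝓝 0) (𝓝 0) :=
    (by fun_prop : Continuous fun lam : ℝ => |t - t₀| * |lam|).tendsto' _ _ (by simp)
  filter_upwards [hc.eventually_lt_const hε] with lam hlam s hs
  refine h ?_
  rw [Real.dist_eq, sub_zero, abs_mul]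
  exact (mul_le_mul_of_nonneg_right (Set.abs_sub_left_of_mem_uIcc hs) (abs_nonneg _)).trans_lt hlam

end Propagator

theorem mainTheorem2 {n : ℕ} (hn : 2 ≤ n) {J : Type*} [Fintype J]
    (γ p : ℝ) (hγ : 0 < γ) (hp : p ∈ Set.Icc (-1 / ((n : ℝ) ^ 2 - 1)) 1)
    (H : Mat n) (hH : H.IsHermitian) (L : J → Mat n) (hL : ∀ j, (L j).trace = 0)
    (t₀ t : ℝ) (Φ : ℝ → ℝ → SuperOp n)
    (hΦ : ∀ lam : ℝ, IsPropagator (freeGenerator n γ p + (lam : ℂ) • gksl H L) t₀ (Φ lam)) :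
    (∀ᶠ lam : ℝ in 𝓝 0, ∀ s ∈ Set.uIcc t₀ t, ∃! K : SuperOp n, IsProjectedGenerator (Φ lam) s K) ∧
    (∀ K : ℝ → SuperOp n, (∀ᶠ lam : ℝ in 𝓝 0, IsProjectedGenerator (Φ lam) t (K lam)) →
      (fun lam : ℝ => K lam - -(depolRate γ p H L t₀ t lam • (1 - fullDepol n)))
        =O[𝓝 0] (fun lam : ℝ => lam ^ 3)) ∧
    (∀ lam : ℝ,
      freeGenerator n γ p + (lam : ℂ) • twirl (gksl H L)
          + ((lam : ℂ) ^ 2 * ((t : ℂ) - (t₀ : ℂ))) •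
            (twirl (gksl H L * gksl H L) - twirl (gksl H L) * twirl (gksl H L))
        = -(depolRate γ p H L t₀ t lam • (1 - fullDepol n))) := by
  simp only [freeGenerator_eq] at hΦ
  have hM := fullDepol_mul_gksl H L
  have hne := eventually_forall_uIcc_flowCoeff_ne_zero hn (gksl H L) t₀ t
  refine ⟨?_, fun K hK => ?_, secondOrderGenerator_eq hn γ p hL t₀ t⟩
  · filter_upwards [hne] with lam hlam s hs
    simp only [(hΦ lam).isProjectedGenerator_iff hn hM (hlam s hs)]
    exact existsUnique_eq
  · have hx : Tendsto (fun lam : ℝ => (t - t₀) * lam) (𝓝 0) (𝓝 0) :=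
      (by fun_prop : Continuous fun lam : ℝ => (t - t₀) * lam).tendsto' _ _ (mul_zero _)
    have h1 := (flowCoeff_logDeriv_isBigO (gksl H L) hn).comp_tendsto hx
    have h2 : ((fun x : ℝ => x ^ 2) ∘ fun lam : ℝ => (t - t₀) * lam) =O[𝓝 0]
        fun lam => lam ^ 2 :=
      IsBigO.of_bound ((t - t₀) ^ 2) (Eventually.of_forall fun x => by simp [mul_pow])
    have h3 : (fun lam : ℝ => (lam : ℂ)) =O[𝓝 0] fun lam : ℝ => lam :=
      IsBigO.of_bound 1 (Eventually.of_forall fun x => by simp)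
    -- The prefactor `lam` of the logarithmic derivative raises the second-order remainder to third
    -- order.
    have h4 := ((h3.mul (h1.trans h2)).congr_right fun x => by ring : _ =O[𝓝 0] fun x : ℝ => x ^ 3)
    have h5 := h4.smul (isBigO_refl (fun _ : ℝ => 1 - fullDepol n) (𝓝 0))
    have h6 : (fun lam : ℝ => lam ^ 3 • (1 - fullDepol n)) =O[𝓝 0] fun lam : ℝ => lam ^ 3 :=
      IsBigO.of_bound ‖1 - fullDepol n‖
        (Eventually.of_forall fun x => by rw [norm_smul, mul_comm])
    refine (h5.trans h6).congr' ?_ EventuallyEq.rfl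
    filter_upwards [hne, hK] with lam hlam hKlam
    rw [((hΦ lam).isProjectedGenerator_iff hn hM (hlam t Set.right_mem_uIcc) _).1 hKlam,
      depolRate_eq hn γ p hL]
    simp only [Function.comp_apply]
    push_cast
    module
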